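/- Let $X=\ell_1$ be the complex Banach space of absolutely summable sequences $(x_j)_{j\ge 0}$ of complex numbers, and let $\mathcal B_1(X)$ be the set of all bounded linear operators $T:X\to X$ with $\|T\|\le 1$, endowed with the strong operator topology (SOT), that is, the topology of pointwise norm convergence on $X$. Let $\mathbb D=\{\lambda\in\mathbb C:|\lambda|<1\}$. Then a typical $T\in(\mathcal B_1(X),\mathrm{SOT})$ has the following properties; that is, the set of all $T\in\mathcal B_1(X)$ having all of them contains a dense $G_\delta$ subset of $(\mathcal B_1(X),\mathrm{SOT})$. (a) The adjoint $T^*:X^*\to X^*$, $T^*\varphi=\varphi\circ T$, is an isometry and is not surjective. (b) $T-\lambda$ is surjective for every $\lambda\in\mathbb D$. (c) Every $\lambda\in\mathbb D$ is an eigenvalue of $T$ of infinite multiplicity, i.e. $\dim\ker(T-\lambda)=\infty$. (d) $\sigma(T)=\sigma_{ap}(T)=\overline{\mathbb D}$, where $\sigma(T)$ is the spectrum of $T$ and $\sigma_{ap}(T)$, the approximate point spectrum, is the set of all $\lambda\in\mathbb C$ for which there is no $c>0$ such that $\|(T-\lambda)x\|\ge c\|x\|$ for all $x\in X$. (e) $\|T^nx\|\to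 0$ as $n\to\infty$ for every $x\in X$. In particular, a typical $T\in(\mathcal B_1(X),\mathrm{SOT})$ has a non-trivial invariant subspace, i.e. a closed linear subspace $E\subseteq X$ with $E\ne\{0\}$, $E\ne X$ and $T(E)\subseteq E$. -/

import Mathlib

open Topology Filter
open scoped lp

/-- The closed unit ball `B₁(X)` of the space of bounded operators on a complex normed space `X`,
i.e. the set of all contractions of `X`, as a type of its own: its topology is the strong operator
topology (see the instance below), not the operator norm topology. -/
structure Contraction (X : Type*) [NormedAddCommGroup X] [NormedSpace ℂ X] where
  /-- The underlying bounded operator. -/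
  op : X →L[ℂ] X
  /-- The operator norm is at most one. -/
  norm_le_one : ‖op‖ ≤ 1

/-- The strong operator topology (SOT) on the set of contractions, induced by Mathlib's topology
of pointwise convergence on the continuous linear maps. -/
noncomputable instance Contraction.instTopologicalSpace (X : Type*) [NormedAddCommGroup X] [NormedSpace ℂ X] :
    TopologicalSpace (Contraction X) :=
  TopologicalSpace.induced
    (fun T : Contraction X => ContinuousLinearMap.toPointwiseConvergenceCLM ℂ (RingHom.id ℂ) X X T.op)
    inferInstance

/-- The topology is the topology of pointwise norm convergence. -/
theorem Contraction.tendsto_iff {X : Type*} [NormedAddCommGroup X] [NormedSpace ℂ X]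
    {ι : Type*} {l : Filter ι} {S : ι → Contraction X} {T : Contraction X} :
    Tendsto S l (𝓝 T) ↔ ∀ x : X, Tendsto (fun i => (S i).op x) l (𝓝 (T.op x)) := by
  rw [nhds_induced, tendsto_comap_iff, PointwiseConvergenceCLM.tendsto_iff_forall_tendsto]
  rfl

/-- A typical `z : Z` satisfies `P`: the set of all `z` satisfying `P` contains a dense `Gδ`
subset of `Z`. -/
def Typical {Z : Type*} [TopologicalSpace Z] (P : Z → Prop) : Prop :=
  ∃ G : Set Z, IsGδ G ∧ Dense G ∧ ∀ z ∈ G, P z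

/-- The Banach space adjoint `T* : X* → X*`, `T* φ = φ ∘ T`, where `X*` is the normed dual. -/
noncomputable def banachAdjoint {X : Type*} [NormedAddCommGroup X] [NormedSpace ℂ X]
    (T : X →L[ℂ] X) : StrongDual ℂ X →L[ℂ] StrongDual ℂ X :=
  ContinuousLinearMap.precomp ℂ T

theorem banachAdjoint_apply {X : Type*} [NormedAddCommGroup X] [NormedSpace ℂ X]
    (T : X →L[ℂ] X) (φ : StrongDual ℂ X) (x : X) : banachAdjoint T φ x = φ (T x) :=
  rfl

/-- An operator is bounded below if `c ‖x‖ ≤ ‖T x‖` for some constant `c > 0` and all `x`. -/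
def IsBoundedBelow {X : Type*} [NormedAddCommGroup X] [NormedSpace ℂ X] (T : X →L[ℂ] X) : Prop :=
  ∃ c : ℝ, 0 < c ∧ ∀ x : X, c * ‖x‖ ≤ ‖T x‖

/-- The approximate point spectrum: all `z` such that `T - z` is not bounded below. -/
def approxPointSpectrum {X : Type*} [NormedAddCommGroup X] [NormedSpace ℂ X]
    (T : X →L[ℂ] X) : Set ℂ :=
  {z : ℂ | ¬ IsBoundedBelow (T - z • ContinuousLinearMap.id ℂ X)}

/-- `z` is an eigenvalue of `T` of infinite multiplicity: it is an eigenvalue and `ker (T - z)` is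
infinite-dimensional. -/
def IsEigenvalueOfInfiniteMultiplicity {X : Type*} [NormedAddCommGroup X] [NormedSpace ℂ X]
    (T : X →L[ℂ] X) (z : ℂ) : Prop :=
  Module.End.HasEigenvalue (T : X →ₗ[ℂ] X) z ∧
    ¬ FiniteDimensional ℂ (Module.End.eigenspace (T : X →ₗ[ℂ] X) z)

/-- `T` has a non-trivial invariant subspace: a closed linear subspace, different from `{0}` and
from `X`, which `T` maps into itself. -/
def HasNontrivialInvariantSubspace {X : Type*} [NormedAddCommGroup X] [NormedSpace ℂ X]
    (T : X →L[ℂ] X) : Prop :=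
  ∃ E : Submodule ℂ X, IsClosed (E : Set X) ∧ E ≠ ⊥ ∧ E ≠ ⊤ ∧ ∀ x ∈ E, T x ∈ E

/-!
The dense `Gδ` set is given by three conditions on the images of the canonical basis vectors `e j`
of `ℓ¹`, each of them a countable conjunction of SOT-open conditions:

* `AlmostHitsBasis`: every `e j` is a limit of images of vectors of the closed unit ball;
* `AlmostKillsBasis`: `‖T (e a)‖ < 1 / 4` for infinitely many `a`;
* `OrbitsApproachZero`: the orbit of every `e j` comes arbitrarily close to `0`.

Operators on `ℓ¹` are prescribed freely by a bounded sequence of columns `T (e j)`. Hence the first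
condition yields, by choosing approximate preimages of the `e j` and correcting with a Neumann
series, right inverses `S` of `T` with norm as close to `1` as desired
(`AlmostHitsBasis.exists_rightInverse`). This makes the adjoint isometric, and the identities
`(T - z) S = 1 - z S` and `T - z = T (1 - z S)`, with `1 - z S` invertible when `‖z S‖ < 1`, show
that `T - z` is onto and that its kernel has the dimension of `ker T`, for every `z` in the open
disc. The second condition makes `ker T` infinite-dimensional: for the infinitely many `a` in
question, the vectors `e a - S (T (e a))` of `ker T` are small perturbations of the `e a`. The
third one gives `T ^ n x → 0` since the norms decrease along an orbit of a contraction. The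
spectrum, the approximate point spectrum and the invariant subspace `ker T` follow at once.

Density needs no Baire category argument. A contraction `T₀` is approximated by operators `T` whose
first `m` columns are those of `r P T₀`, with `P` the projection onto the first `m` coordinates and
`r < 1`, while `e (m + 2 i)` is sent to `e i` and `e (m + 2 i + 1)` to `0`. Such a `T` hits every
`e j`, kills infinitely many of them, and every basis vector is moved into the span of the first `m`
ones, where `T` is a strict contraction (`dense_almostHits_almostKills_orbitsApproachZero`).
-/

/-! ### Operators on `ℓ¹` and their columns -/

/-- The `j`-th vector of the canonical basis of `ℓ¹`. -/
noncomputable def basisVec (j : ℕ) : ℓ¹(ℕ, ℂ) := lp.single 1 j (1 : ℂ)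

theorem norm_basisVec (j : ℕ) : ‖basisVec j‖ = 1 := by
  simp [basisVec]

theorem hasSum_norm_coord (x : ℓ¹(ℕ, ℂ)) : HasSum (fun j => ‖x j‖) ‖x‖ := by
  simpa using lp.hasSum_norm (p := 1) (by simp) x

theorem hasSum_basisVec (x : ℓ¹(ℕ, ℂ)) : HasSum (fun j => x j • basisVec j) x := by
  convert lp.hasSum_single (p := 1) (by simp) x using 2 with j
  rw [basisVec, ← lp.single_smul]
  simp

theorem norm_sum_smul_basisVec (s : Finset ℕ) (g : ℕ → ℂ) :
    ‖∑ a ∈ s, g a • basisVec a‖ = ∑ a ∈ s, ‖g a‖ := by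
  have h := lp.norm_sum_single (E := fun _ : ℕ => ℂ) (p := 1) (by simp) g s
  simp only [ENNReal.toReal_one, Real.rpow_one] at h
  rw [← h]
  congr 1
  refine Finset.sum_congr rfl fun a _ => ?_
  rw [basisVec, ← lp.single_smul]
  simp

theorem ext_basisVec {F : Type*} [NormedAddCommGroup F] [NormedSpace ℂ F]
    {A B : ℓ¹(ℕ, ℂ) →L[ℂ] F} (h : ∀ j, A (basisVec j) = B (basisVec j)) : A = B := by
  ext x
  have hA := (hasSum_basisVec x).mapL A
  have hB := (hasSum_basisVec x).mapL B
  simp only [map_smul, h] at hA hB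
  exact hA.unique hB

theorem opNorm_le_of_basisVec {F : Type*} [NormedAddCommGroup F] [NormedSpace ℂ F]
    {A : ℓ¹(ℕ, ℂ) →L[ℂ] F} {C : ℝ} (h : ∀ j, ‖A (basisVec j)‖ ≤ C) : ‖A‖ ≤ C := by
  refine A.opNorm_le_bound ((norm_nonneg _).trans (h 0)) fun x => ?_
  have hA := (hasSum_basisVec x).mapL A
  have hb := (hasSum_norm_coord x).mul_left C
  rw [← hA.tsum_eq]
  refine tsum_of_norm_bounded hb fun j => ?_
  rw [map_smul, norm_smul, mul_comm]
  exact mul_le_mul_of_nonneg_right (h j) (norm_nonneg _)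

/-- A bounded sequence of vectors is the sequence of columns of an operator on `ℓ¹`. -/
theorem exists_clm_basisVec {F : Type*} [NormedAddCommGroup F] [NormedSpace ℂ F] [CompleteSpace F]
    (c : ℕ → F) {C : ℝ} (hc : ∀ j, ‖c j‖ ≤ C) :
    ∃ A : ℓ¹(ℕ, ℂ) →L[ℂ] F, ‖A‖ ≤ C ∧ ∀ j, A (basisVec j) = c j := by
  have hbd : ∀ (x : ℓ¹(ℕ, ℂ)) j, ‖x j • c j‖ ≤ C * ‖x j‖ := fun x j => by
    rw [norm_smul, mul_comm]
    exact mul_le_mul_of_nonneg_right (hc j) (norm_nonneg _)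
  have hs : ∀ x : ℓ¹(ℕ, ℂ), Summable fun j => x j • c j := fun x =>
    .of_norm_bounded ((hasSum_norm_coord x).mul_left C).summable (hbd x)
  let A₀ : ℓ¹(ℕ, ℂ) →ₗ[ℂ] F :=
    { toFun := fun x => ∑' j, x j • c j
      map_add' := fun x y => by
        rw [← (hs x).tsum_add (hs y)]
        simp [add_smul]
      map_smul' := fun a x => by
        rw [RingHom.id_apply, ← (hs x).tsum_const_smul]
        simp [mul_smul] }
  let A := A₀.mkContinuous C fun x =>
    tsum_of_norm_bounded ((hasSum_norm_coord x).mul_left C) (hbd x)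
  have hA : ∀ j, A (basisVec j) = c j := fun j => by
    change ∑' i, basisVec j i • c i = c j
    rw [tsum_eq_single j]
    · simp [basisVec]
    · intro i hi
      simp [basisVec, hi]
  exact ⟨A, opNorm_le_of_basisVec fun j => (hA j).symm ▸ hc j, hA⟩

theorem norm_apply_le_of_norm_le_one {X : Type*} [NormedAddCommGroup X] [NormedSpace ℂ X]
    {A : X →L[ℂ] X} (hA : ‖A‖ ≤ 1) (x : X) : ‖A x‖ ≤ ‖x‖ := by
  simpa using A.le_of_opNorm_le hA x

theorem norm_pow_le_one {X : Type*} [NormedAddCommGroup X] [NormedSpace ℂ X]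
    {A : X →L[ℂ] X} (hA : ‖A‖ ≤ 1) (n : ℕ) : ‖A ^ n‖ ≤ 1 := by
  induction n with
  | zero => exact ContinuousLinearMap.norm_id_le
  | succ n ih =>
    rw [pow_succ]
    exact (norm_mul_le _ _).trans (mul_le_one₀ ih (norm_nonneg _) hA)

/-- Among contractions of `ℓ¹`, strong convergence can be tested on the canonical basis. -/
theorem tendsto_apply_of_tendsto_basisVec {ι : Type*} {l : Filter ι}
    {A : ι → ℓ¹(ℕ, ℂ) →L[ℂ] ℓ¹(ℕ, ℂ)} {B : ℓ¹(ℕ, ℂ) →L[ℂ] ℓ¹(ℕ, ℂ)}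
    (hA : ∀ i, ‖A i‖ ≤ 1) (hB : ‖B‖ ≤ 1)
    (h : ∀ j, Tendsto (fun i => A i (basisVec j)) l (𝓝 (B (basisVec j)))) (x : ℓ¹(ℕ, ℂ)) :
    Tendsto (fun i => A i x) l (𝓝 (B x)) := by
  have key := hasSum_basisVec x
  rw [Metric.tendsto_nhds]
  intro ε hε
  obtain ⟨s, hs⟩ := ((Metric.tendsto_nhds.1 key (ε / 4) (by positivity)).exists)
  set y := ∑ j ∈ s, x j • basisVec j with hy
  have hlim : Tendsto (fun i => A i y) l (𝓝 (B y)) := by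
    simp only [hy, map_sum, map_smul]
    exact tendsto_finsetSum _ fun j _ => (h j).const_smul _
  filter_upwards [Metric.tendsto_nhds.1 hlim (ε / 4) (by positivity)] with i hi
  rw [dist_eq_norm] at hs hi ⊢
  have h1 : ‖A i (y - x)‖ ≤ ‖y - x‖ := norm_apply_le_of_norm_le_one (hA i) _
  have h2 : ‖B (y - x)‖ ≤ ‖y - x‖ := norm_apply_le_of_norm_le_one hB _
  have h3 : A i x - B x = (A i y - B y) - A i (y - x) + B (y - x) := by
    simp only [map_sub]; abel
  rw [h3]
  have := norm_add_le ((A i y - B y) - A i (y - x)) (B (y - x))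
  have := norm_sub_le (A i y - B y) (A i (y - x))
  linarith

/-! ### The three conditions and their consequences -/

/-- Powers are SOT-continuous on contractions: multiplication is jointly SOT-continuous on bounded
sets. -/
theorem continuous_pow_apply {X : Type*} [NormedAddCommGroup X] [NormedSpace ℂ X] (n : ℕ) (x : X) :
    Continuous fun T : Contraction X => (T.op ^ n) x := by
  induction n with
  | zero => simpa using continuous_const
  | succ n ih =>
    rw [continuous_iff_continuousAt] at ih ⊢
    intro T
    have h1 := (ih T).tendsto
    have h2 := Contraction.tendsto_iff.1 (tendsto_id (α := Contraction X) (x := 𝓝 T)) ((T.op ^ n) x)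
    have h3 : Tendsto (fun S : Contraction X => S.op ((S.op ^ n) x - (T.op ^ n) x)) (𝓝 T) (𝓝 0) := by
      refine squeeze_zero_norm (fun S => norm_apply_le_of_norm_le_one S.norm_le_one _) ?_
      simpa using (h1.sub_const ((T.op ^ n) x)).norm
    have h4 := h3.add h2
    simp only [map_sub, id, sub_add_cancel, zero_add] at h4
    simpa only [ContinuousAt, pow_succ', mul_apply_eq_comp] using h4

theorem continuous_op_apply {X : Type*} [NormedAddCommGroup X] [NormedSpace ℂ X] (x : X) :
    Continuous fun T : Contraction X => T.op x := by
  simpa using continuous_pow_apply 1 x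

/-- Every basis vector is a limit of images of vectors of the closed unit ball. For a contraction
of `ℓ¹` this says that it is a metric quotient map. -/
def AlmostHitsBasis (T : ℓ¹(ℕ, ℂ) →L[ℂ] ℓ¹(ℕ, ℂ)) : Prop :=
  ∀ j k : ℕ, ∃ x, ‖x‖ ≤ 1 ∧ ‖T x - basisVec j‖ < 1 / (k + 1 : ℝ)

/-- The norm of `T (e a)` is less than `1 / 4` for infinitely many `a`. The bound `1 / 4` is small
against `1 / 2`, the inverse of the norm allowed to a right inverse in
`AlmostKillsBasis.not_finiteDimensional_ker`. -/
def AlmostKillsBasis (T : ℓ¹(ℕ, ℂ) →L[ℂ] ℓ¹(ℕ, ℂ)) : Prop :=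
  ∀ k : ℕ, ∃ a ≥ k, ‖T (basisVec a)‖ < 1 / 4

/-- The orbit of every basis vector comes arbitrarily close to `0`. Quantifying over the basis
vectors only keeps this a countable conjunction. -/
def OrbitsApproachZero (T : ℓ¹(ℕ, ℂ) →L[ℂ] ℓ¹(ℕ, ℂ)) : Prop :=
  ∀ j k : ℕ, ∃ n : ℕ, ‖(T ^ n) (basisVec j)‖ < 1 / (k + 1 : ℝ)

theorem isGδ_almostHitsBasis : IsGδ {T : Contraction ℓ¹(ℕ, ℂ) | AlmostHitsBasis T.op} := by
  simp only [AlmostHitsBasis, Set.ofPred_forall, Set.ofPred_exists, ← exists_prop]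
  refine .iInter fun j => .iInter_of_isOpen fun k =>
    isOpen_iUnion fun x => isOpen_iUnion fun _ => ?_
  exact isOpen_lt ((continuous_op_apply x).sub continuous_const).norm continuous_const

theorem isGδ_almostKillsBasis : IsGδ {T : Contraction ℓ¹(ℕ, ℂ) | AlmostKillsBasis T.op} := by
  simp only [AlmostKillsBasis, Set.ofPred_forall, Set.ofPred_exists, ← exists_prop]
  refine .iInter_of_isOpen fun k => isOpen_iUnion fun a => isOpen_iUnion fun _ => ?_
  exact isOpen_lt (continuous_op_apply _).norm continuous_const

theorem isGδ_orbitsApproachZero : IsGδ {T : Contraction ℓ¹(ℕ, ℂ) | OrbitsApproachZero T.op} := by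
  simp only [OrbitsApproachZero, Set.ofPred_forall, Set.ofPred_exists]
  refine .iInter fun j => .iInter_of_isOpen fun k => isOpen_iUnion fun n => ?_
  exact isOpen_lt (continuous_pow_apply n _).norm continuous_const

theorem OrbitsApproachZero.tendsto {T : ℓ¹(ℕ, ℂ) →L[ℂ] ℓ¹(ℕ, ℂ)} (hT : ‖T‖ ≤ 1)
    (h : OrbitsApproachZero T) (x : ℓ¹(ℕ, ℂ)) : Tendsto (fun n => (T ^ n) x) atTop (𝓝 0) := by
  refine tendsto_apply_of_tendsto_basisVec (B := 0) (norm_pow_le_one hT) (by simp) (fun j => ?_) x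
  have hanti : Antitone fun n => ‖(T ^ n) (basisVec j)‖ := antitone_nat_of_succ_le fun n => by
    rw [pow_succ']
    exact norm_apply_le_of_norm_le_one hT _
  rw [zero_apply, tendsto_zero_iff_norm_tendsto_zero, Metric.tendsto_atTop]
  intro ε hε
  obtain ⟨k, hk⟩ := exists_nat_one_div_lt hε
  obtain ⟨n, hn⟩ := h j k
  refine ⟨n, fun i hi => ?_⟩
  simpa using ((hanti hi).trans_lt hn).trans hk

/-- A two-sided inverse of `1 - A` by the Neumann series, free of coercions from units. -/
theorem exists_inverse_one_sub {X : Type*} [NormedAddCommGroup X] [NormedSpace ℂ X]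
    [CompleteSpace X] {A : X →L[ℂ] X} (hA : ‖A‖ < 1) :
    ∃ V : X →L[ℂ] X, (1 - A) * V = 1 ∧ V * (1 - A) = 1 :=
  let ⟨U, hU⟩ := (Units.oneSub A hA).isUnit
  ⟨((U⁻¹ : (X →L[ℂ] X)ˣ) : X →L[ℂ] X), by
    rw [← Units.val_oneSub A hA, ← hU]; exact ⟨Units.mul_inv U, Units.inv_mul U⟩⟩

/-- Approximate preimages `u j` of the basis vectors are the columns of a contraction `S₀` with
`‖1 - T S₀‖ ≤ 1 - 1 / r`; then `S₀ (T S₀)⁻¹` is a right inverse of norm at most `r`. -/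
theorem AlmostHitsBasis.exists_rightInverse {T : ℓ¹(ℕ, ℂ) →L[ℂ] ℓ¹(ℕ, ℂ)}
    (h : AlmostHitsBasis T) {r : ℝ} (hr : 1 < r) : ∃ S, T * S = 1 ∧ ‖S‖ ≤ r := by
  have hr0 : 0 < r := by linarith
  have hpos : 0 < 1 - 1 / r := by
    rw [sub_pos, div_lt_one hr0]; exact hr
  obtain ⟨k, hk⟩ := exists_nat_one_div_lt hpos
  choose u hu huT using fun j => h j k
  obtain ⟨S₀, hS₀, hS₀u⟩ := exists_clm_basisVec u hu
  set R := 1 - T * S₀ with hR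
  have hRn : ‖R‖ ≤ 1 - 1 / r := opNorm_le_of_basisVec fun j => by
    have : R (basisVec j) = -(T (u j) - basisVec j) := by simp [hR, hS₀u]
    rw [this, norm_neg]
    exact (huT j).le.trans hk.le
  have hR1 : ‖R‖ < 1 := hRn.trans_lt (by simpa using hr0)
  obtain ⟨V, hRV, hVR⟩ := exists_inverse_one_sub hR1
  have hTS : T * S₀ = 1 - R := by rw [hR]; abel
  set S := S₀ * V with hS
  have hSR : S = S₀ + S * R := by
    have hSU : S * (1 - R) = S₀ := by rw [hS, mul_assoc, hVR, mul_one]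
    rw [mul_sub, mul_one] at hSU
    rw [← hSU]; abel
  refine ⟨S, by rw [hS, ← mul_assoc, hTS, hRV], ?_⟩
  have h1 : ‖S‖ ≤ 1 + ‖S‖ * (1 - 1 / r) := by
    calc ‖S‖ = ‖S₀ + S * R‖ := by rw [← hSR]
      _ ≤ ‖S₀‖ + ‖S‖ * ‖R‖ := (norm_add_le _ _).trans (by gcongr; exact norm_mul_le _ _)
      _ ≤ _ := by gcongr
  have h2 : ‖S‖ / r ≤ 1 := by
    rw [div_eq_mul_one_div]; linarith
  rwa [div_le_one hr0] at h2

/-- If `T S = 1`, then `e a - S (T (e a))` lies in `ker T`. These vectors are linearly independent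
over the set of all `a` with `‖T (e a)‖ < 1 / 4`: a combination `x` of such `e a` with `x = S (T x)`
satisfies `‖x‖ ≤ 2 ‖T x‖ ≤ ‖x‖ / 2`. -/
theorem AlmostKillsBasis.not_finiteDimensional_ker {T S : ℓ¹(ℕ, ℂ) →L[ℂ] ℓ¹(ℕ, ℂ)}
    (h : AlmostKillsBasis T) (hTS : T * S = 1) (hS : ‖S‖ ≤ 2) :
    ¬ FiniteDimensional ℂ T.ker := by
  intro hfin
  set A : Set ℕ := {a | ‖T (basisVec a)‖ < 1 / 4} with hA
  have hinf : A.Infinite := Set.infinite_of_not_bddAbove fun ⟨k, hk⟩ => by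
    obtain ⟨a, ha, haT⟩ := h (k + 1)
    have : a ≤ k := hk haT
    omega
  have hTSx : ∀ x, T (S x) = x := fun x => DFunLike.congr_fun hTS x
  have hker : ∀ a, basisVec a - S (T (basisVec a)) ∈ T.ker := fun a => by
    rw [LinearMap.mem_ker]
    simp [hTSx]
  let v : A → T.ker := fun a => ⟨_, hker a⟩
  have hind : LinearIndependent ℂ v := by
    refine .of_comp T.ker.subtype ?_
    change LinearIndepOn ℂ (fun a => basisVec a - S (T (basisVec a))) A
    rw [linearIndepOn_iff']
    intro s g hs hsum
    set x := ∑ a ∈ s, g a • basisVec a with hx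
    have hxS : x = S (T x) := by
      rw [← sub_eq_zero, ← hsum, hx]
      simp only [map_sum, map_smul, smul_sub, Finset.sum_sub_distrib]
    have hTx : ‖T x‖ ≤ ‖x‖ * (1 / 4) := by
      rw [hx, norm_sum_smul_basisVec, map_sum, Finset.sum_mul]
      refine norm_sum_le_of_le _ fun a ha => ?_
      rw [map_smul, norm_smul]
      exact mul_le_mul_of_nonneg_left (hs ha).le (norm_nonneg _)
    have hx0 : ‖x‖ ≤ 2 * ‖T x‖ := by
      conv_lhs => rw [hxS]
      exact S.le_of_opNorm_le hS _
    have hzero : ∑ a ∈ s, ‖g a‖ = 0 := by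
      rw [← norm_sum_smul_basisVec, ← hx]
      linarith [norm_nonneg x]
    intro a ha
    exact norm_eq_zero.1 ((Finset.sum_eq_zero_iff_of_nonneg fun _ _ => norm_nonneg _).1 hzero a ha)
  exact hinf (Set.finite_coe_iff.1 hind.finite)

/-! ### Perturbing a right invertible operator -/

section RightInverse

variable {X : Type*} [NormedAddCommGroup X] [NormedSpace ℂ X] [CompleteSpace X]
  {T S : X →L[ℂ] X} {z : ℂ}

theorem surjective_sub_smul (hTS : T * S = 1) (hz : ‖z • S‖ < 1) :
    Function.Surjective (T - z • ContinuousLinearMap.id ℂ X) := by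
  obtain ⟨V, hV, -⟩ := exists_inverse_one_sub hz
  have h : (T - z • 1) * (S * V) = 1 := by
    rw [← mul_assoc, sub_mul, hTS, smul_mul_assoc, one_mul, hV]
  exact fun y => ⟨S (V y), DFunLike.congr_fun h y⟩

/-- Since `T - z = T (1 - z S)`, the invertible operator `1 - z S` maps the eigenspace onto
`ker T`. -/
theorem not_finiteDimensional_eigenspace (hTS : T * S = 1) (hz : ‖z • S‖ < 1)
    (hker : ¬ FiniteDimensional ℂ T.ker) :
    ¬ FiniteDimensional ℂ (Module.End.eigenspace (T : X →ₗ[ℂ] X) z) := by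
  obtain ⟨V, hV, -⟩ := exists_inverse_one_sub hz
  have h : T * (1 - z • S) = T - z • 1 := by
    rw [mul_sub, mul_one, mul_smul_comm, hTS]
  intro hfin
  refine hker (Submodule.finiteDimensional_of_le (S₂ := (Module.End.eigenspace
    (T : X →ₗ[ℂ] X) z).map ((1 - z • S : X →L[ℂ] X) : X →ₗ[ℂ] X)) fun y hy => ?_)
  have hVy : (1 - z • S) (V y) = y := DFunLike.congr_fun hV y
  refine ⟨V y, ?_, hVy⟩
  have h1 : T ((1 - z • S) (V y)) = (T - z • 1) (V y) := DFunLike.congr_fun h (V y)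
  have hTy : T y = 0 := hy
  rw [hVy, hTy] at h1
  rw [SetLike.mem_coe, Module.End.mem_eigenspace_iff, ← sub_eq_zero]
  exact h1.symm

end RightInverse

theorem isEigenvalueOfInfiniteMultiplicity_iff {X : Type*} [NormedAddCommGroup X]
    [NormedSpace ℂ X] {T : X →L[ℂ] X} {z : ℂ} : IsEigenvalueOfInfiniteMultiplicity T z ↔
      ¬ FiniteDimensional ℂ (Module.End.eigenspace (T : X →ₗ[ℂ] X) z) := by
  refine ⟨fun h => h.2, fun h => ⟨Module.End.hasEigenvalue_iff.2 fun h0 => h ?_, h⟩⟩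
  rw [h0]
  infer_instance

/-! ### The spectrum and the approximate point spectrum -/

section Spectrum

variable {X : Type*} [NormedAddCommGroup X] [NormedSpace ℂ X] {T : X →L[ℂ] X}

theorem approxPointSpectrum_subset_spectrum (T : X →L[ℂ] X) :
    approxPointSpectrum T ⊆ spectrum ℂ T := by
  intro z hz hunit
  rw [spectrum.mem_resolventSet_iff, IsUnit.sub_iff] at hunit
  obtain ⟨U, hU⟩ := hunit
  refine hz ⟨(‖((U⁻¹ : (X →L[ℂ] X)ˣ) : X →L[ℂ] X)‖ + 1)⁻¹, by positivity, fun x => ?_⟩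
  have hx : ((U⁻¹ : (X →L[ℂ] X)ˣ) : X →L[ℂ] X) ((U : X →L[ℂ] X) x) = x :=
    DFunLike.congr_fun (Units.inv_mul U) x
  have hUx : (U : X →L[ℂ] X) x = (T - z • ContinuousLinearMap.id ℂ X) x := by
    rw [hU, Algebra.algebraMap_eq_smul_one]; rfl
  rw [inv_mul_le_iff₀ (by positivity), ← hUx]
  calc ‖x‖ = ‖((U⁻¹ : (X →L[ℂ] X)ˣ) : X →L[ℂ] X) ((U : X →L[ℂ] X) x)‖ := by rw [hx]
    _ ≤ _ := ContinuousLinearMap.le_opNorm _ _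
    _ ≤ _ := by gcongr; linarith

theorem spectrum_subset_closedBall (hT : ‖T‖ ≤ 1) [CompleteSpace X] :
    spectrum ℂ T ⊆ Metric.closedBall (0 : ℂ) 1 := by
  intro z hz
  have := spectrum.norm_le_norm_mul_of_mem hz
  rw [mem_closedBall_zero_iff]
  exact this.trans (mul_le_one₀ hT (norm_nonneg _) ContinuousLinearMap.norm_id_le)

theorem isClosed_approxPointSpectrum (T : X →L[ℂ] X) : IsClosed (approxPointSpectrum T) := by
  rw [← isOpen_compl_iff, Metric.isOpen_iff]
  intro z hz
  obtain ⟨c, hc, h⟩ := not_not.1 hz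
  refine ⟨c / 2, by positivity, fun w hw => not_not.2 ⟨c / 2, by positivity, fun x => ?_⟩⟩
  rw [Metric.mem_ball, dist_eq_norm] at hw
  have h1 := h x
  have h2 : (T - z • ContinuousLinearMap.id ℂ X) x =
      (T - w • ContinuousLinearMap.id ℂ X) x + (w - z) • x := by
    simp [sub_smul]
  rw [h2] at h1
  have h3 := norm_add_le ((T - w • ContinuousLinearMap.id ℂ X) x) ((w - z) • x)
  rw [norm_smul] at h3
  nlinarith [norm_nonneg x]

theorem mem_approxPointSpectrum_of_hasEigenvalue {z : ℂ}
    (h : Module.End.HasEigenvalue (T : X →ₗ[ℂ] X) z) : z ∈ approxPointSpectrum T := by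
  rintro ⟨c, hc, hb⟩
  obtain ⟨x, hx, hx0⟩ := h.exists_hasEigenvector
  have h1 := hb x
  have h2 : (T - z • ContinuousLinearMap.id ℂ X) x = 0 :=
    sub_eq_zero.2 (Module.End.mem_eigenspace_iff.1 hx)
  rw [h2, norm_zero] at h1
  have := mul_pos hc (norm_pos_iff.2 hx0)
  linarith

theorem closedBall_subset_approxPointSpectrum
    (h : ∀ z ∈ Metric.ball (0 : ℂ) 1, Module.End.HasEigenvalue (T : X →ₗ[ℂ] X) z) :
    Metric.closedBall (0 : ℂ) 1 ⊆ approxPointSpectrum T := by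
  rw [← closure_ball _ one_ne_zero]
  exact closure_minimal (fun z hz => mem_approxPointSpectrum_of_hasEigenvalue (h z hz))
    (isClosed_approxPointSpectrum T)

end Spectrum

/-! ### The adjoint and the invariant subspace -/

theorem isometry_banachAdjoint {X : Type*} [NormedAddCommGroup X] [NormedSpace ℂ X]
    {T : X →L[ℂ] X} (hT : ‖T‖ ≤ 1) (h : ∀ r : ℝ, 1 < r → ∃ S, T * S = 1 ∧ ‖S‖ ≤ r) :
    Isometry (banachAdjoint T) := by
  refine AddMonoidHomClass.isometry_of_norm _ fun φ => le_antisymm ?_ ?_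
  · change ‖φ.comp T‖ ≤ ‖φ‖
    exact (φ.opNorm_comp_le T).trans (mul_le_of_le_one_right (norm_nonneg _) hT)
  · have key : ∀ r : ℝ, 1 < r → ‖φ‖ ≤ ‖banachAdjoint T φ‖ * r := fun r hr => by
      obtain ⟨S, hTS, hS⟩ := h r hr
      have : φ = (φ.comp T).comp S := by
        ext x
        exact congrArg φ (DFunLike.congr_fun hTS x).symm
      calc ‖φ‖ = ‖(φ.comp T).comp S‖ := by rw [← this]
        _ ≤ ‖φ.comp T‖ * ‖S‖ := ContinuousLinearMap.opNorm_comp_le _ _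
        _ ≤ _ := mul_le_mul_of_nonneg_left hS (norm_nonneg _)
    have hlim : Tendsto (fun r : ℝ => ‖banachAdjoint T φ‖ * r) (𝓝[>] 1)
        (𝓝 (‖banachAdjoint T φ‖ * 1)) :=
      ((continuous_const.mul continuous_id).tendsto 1).mono_left nhdsWithin_le_nhds
    rw [mul_one] at hlim
    exact ge_of_tendsto hlim (eventually_nhdsWithin_of_forall key)

theorem not_surjective_banachAdjoint {X : Type*} [NormedAddCommGroup X] [NormedSpace ℂ X]
    {T : X →L[ℂ] X} (h : T.ker ≠ ⊥) : ¬ Function.Surjective (banachAdjoint T) := by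
  obtain ⟨x, hx, hx0⟩ := Submodule.exists_mem_ne_zero_of_ne_bot h
  intro hs
  obtain ⟨φ, -, hφ⟩ := exists_dual_vector ℂ x (norm_ne_zero_iff.2 hx0)
  obtain ⟨ψ, rfl⟩ := hs φ
  have hTx : T x = 0 := hx
  rw [banachAdjoint_apply, hTx, map_zero] at hφ
  exact hx0 (by simpa using hφ.symm)

theorem hasNontrivialInvariantSubspace_of_ker {X : Type*} [NormedAddCommGroup X] [NormedSpace ℂ X]
    {T : X →L[ℂ] X} (hbot : T.ker ≠ ⊥) (hT : Function.Surjective T) :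
    HasNontrivialInvariantSubspace T := by
  refine ⟨T.ker, T.isClosed_ker, hbot, fun htop => hbot ?_, fun x hx => ?_⟩
  · refine (Submodule.eq_bot_iff _).2 fun y _ => ?_
    obtain ⟨x, rfl⟩ := hT y
    exact LinearMap.mem_ker.1 (htop ▸ Submodule.mem_top : x ∈ T.ker)
  · have hTx : T x = 0 := hx
    rw [hTx]
    exact zero_mem _

/-! ### Density -/

/-- The projection onto the first `m` coordinates. -/
theorem exists_coordTruncation (m : ℕ) : ∃ P : ℓ¹(ℕ, ℂ) →L[ℂ] ℓ¹(ℕ, ℂ), ‖P‖ ≤ 1 ∧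
    ∀ j, P (basisVec j) = if j < m then basisVec j else 0 :=
  exists_clm_basisVec _ fun j => by
    split_ifs
    · rw [norm_basisVec]
    · simp

/-- The columns of an operator close to `T₀` that satisfies the three conditions: the first `m`
columns are those of `r P T₀`, the later ones are alternately `e 0, 0, e 1, 0, e 2, 0, …`. It is
meant for `‖r‖ < 1` and `P` the projection onto the first `m` coordinates. -/
noncomputable def modelColumn (m : ℕ) (r : ℂ) (P T₀ : ℓ¹(ℕ, ℂ) →L[ℂ] ℓ¹(ℕ, ℂ)) (j : ℕ) : ℓ¹(ℕ, ℂ) :=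
  if j < m then r • P (T₀ (basisVec j))
  else if Even (j - m) then basisVec ((j - m) / 2) else 0

theorem norm_modelColumn_le {m : ℕ} {r : ℂ} {P T₀ : ℓ¹(ℕ, ℂ) →L[ℂ] ℓ¹(ℕ, ℂ)}
    (hr : ‖r‖ ≤ 1) (hP : ‖P‖ ≤ 1) (hT₀ : ‖T₀‖ ≤ 1) (j : ℕ) :
    ‖modelColumn m r P T₀ j‖ ≤ 1 := by
  unfold modelColumn
  split_ifs
  · rw [norm_smul]
    refine mul_le_one₀ hr (norm_nonneg _) ?_
    calc _ ≤ _ := norm_apply_le_of_norm_le_one hP _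
      _ ≤ _ := norm_apply_le_of_norm_le_one hT₀ _
      _ = 1 := norm_basisVec j
  · rw [norm_basisVec]
  · simp

theorem almostHitsBasis_of_modelColumn {m : ℕ} {r : ℂ} {P T₀ T : ℓ¹(ℕ, ℂ) →L[ℂ] ℓ¹(ℕ, ℂ)}
    (hT : ∀ j, T (basisVec j) = modelColumn m r P T₀ j) : AlmostHitsBasis T := by
  intro j k
  refine ⟨basisVec (m + (j + j)), (norm_basisVec _).le, ?_⟩
  have : T (basisVec (m + (j + j))) = basisVec j := by
    rw [hT, modelColumn, if_neg (by omega), if_pos ⟨j, by omega⟩]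
    congr 1
    omega
  rw [this, sub_self, norm_zero]
  positivity

theorem almostKillsBasis_of_modelColumn {m : ℕ} {r : ℂ} {P T₀ T : ℓ¹(ℕ, ℂ) →L[ℂ] ℓ¹(ℕ, ℂ)}
    (hT : ∀ j, T (basisVec j) = modelColumn m r P T₀ j) : AlmostKillsBasis T := by
  intro k
  refine ⟨m + (2 * k + 1), by omega, ?_⟩
  rw [hT, modelColumn, if_neg (by omega), if_neg]
  · simp
  · rw [Nat.not_even_iff_odd]
    exact ⟨k, by omega⟩

/-- On the range of `P` the operator acts as `r P T₀`, so orbits there decay like `‖r‖ ^ n`; a basis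
vector outside of it is sent to `0` or to a basis vector of smaller index. The latter fails for
`m = 0`, where `e 0` would be a fixed point. -/
theorem orbitsApproachZero_of_modelColumn {m : ℕ} {r : ℂ} {P T₀ T : ℓ¹(ℕ, ℂ) →L[ℂ] ℓ¹(ℕ, ℂ)}
    (hm : 0 < m) (hr : ‖r‖ < 1) (hP : ‖P‖ ≤ 1) (hT₀ : ‖T₀‖ ≤ 1)
    (hPe : ∀ j, P (basisVec j) = if j < m then basisVec j else 0)
    (hT : ∀ j, T (basisVec j) = modelColumn m r P T₀ j) : OrbitsApproachZero T := by
  have hTP : T * P = P * (r • T₀ * P) := ext_basisVec fun j => by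
    simp only [mul_apply_eq_comp, hPe]
    split_ifs with hj
    · simp [hT, modelColumn, hj]
    · simp
  have hB : ∀ x, ‖(r • T₀ * P) x‖ ≤ ‖r‖ * ‖x‖ := fun x => by
    change ‖r • T₀ (P x)‖ ≤ _
    rw [norm_smul]
    gcongr
    exact (norm_apply_le_of_norm_le_one hT₀ _).trans (norm_apply_le_of_norm_le_one hP _)
  have hpow : ∀ (n : ℕ) x, ‖(T ^ n) (P x)‖ ≤ ‖r‖ ^ n * ‖x‖ := by
    intro n
    induction n with
    | zero => intro x; simpa using norm_apply_le_of_norm_le_one hP x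
    | succ n ih =>
      intro x
      have h1 : (T ^ (n + 1)) (P x) = (T ^ n) (P ((r • T₀ * P) x)) := by
        rw [pow_succ]
        exact congrArg (T ^ n) (DFunLike.congr_fun hTP x)
      rw [h1, pow_succ, mul_assoc]
      exact (ih _).trans (mul_le_mul_of_nonneg_left (hB x) (by positivity))
  have hlim : ∀ j, Tendsto (fun n => (T ^ n) (basisVec j)) atTop (𝓝 0) := by
    intro j
    induction j using Nat.strong_induction_on with
    | _ j ih =>
      by_cases hj : j < m
      · have hPj : P (basisVec j) = basisVec j := by rw [hPe, if_pos hj]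
        refine squeeze_zero_norm (a := fun n => ‖r‖ ^ n) (fun n => ?_)
          (tendsto_pow_atTop_nhds_zero_of_lt_one (norm_nonneg _) hr)
        simpa [hPj, norm_basisVec] using hpow n (basisVec j)
      · rw [← tendsto_add_atTop_iff_nat 1]
        simp only [pow_succ, mul_apply_eq_comp, hT, modelColumn, if_neg hj]
        split_ifs
        · exact ih _ (by omega)
        · simp
  intro j k
  have := (tendsto_zero_iff_norm_tendsto_zero.1 (hlim j)).eventually_lt_const
    (Nat.one_div_pos_of_nat (n := k) (α := ℝ))
  exact this.exists

/-- The approximations `T` of `T₀` take `r = m / (m + 1)`, so that `r P T₀ (e j) → T₀ (e j)` as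
`m → ∞`. -/
theorem dense_almostHits_almostKills_orbitsApproachZero : Dense {T : Contraction ℓ¹(ℕ, ℂ) |
    AlmostHitsBasis T.op ∧ AlmostKillsBasis T.op ∧ OrbitsApproachZero T.op} := by
  intro T₀
  choose P hP hPe using exists_coordTruncation
  let r : ℕ → ℂ := fun m => (m : ℂ) / (m + 1)
  have hr : ∀ m, ‖r m‖ < 1 := fun m => by
    have h1 : ‖(m : ℂ) + 1‖ = m + 1 := by
      exact_mod_cast Complex.norm_natCast (m + 1)
    rw [norm_div, h1, Complex.norm_natCast, div_lt_one (by positivity)]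
    linarith
  choose A hA hAe using fun m : ℕ =>
    exists_clm_basisVec _ (norm_modelColumn_le (m := m) (hr m).le (hP m) T₀.norm_le_one)
  have hPx : ∀ x, Tendsto (fun m => P m x) atTop (𝓝 x) :=
    tendsto_apply_of_tendsto_basisVec (B := 1) hP ContinuousLinearMap.norm_id_le fun j =>
      tendsto_const_nhds.congr' <| (eventually_gt_atTop j).mono fun m hm => by
        simp [hPe, hm]
  have hr1 : Tendsto r atTop (𝓝 1) := tendsto_natCast_div_add_atTop 1
  have hlim : Tendsto (fun m => (⟨A m, hA m⟩ : Contraction ℓ¹(ℕ, ℂ))) atTop (𝓝 T₀) := by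
    refine Contraction.tendsto_iff.2 <|
      tendsto_apply_of_tendsto_basisVec hA T₀.norm_le_one fun j => ?_
    have h1 : Tendsto (fun m => r m • P m (T₀.op (basisVec j))) atTop
        (𝓝 (T₀.op (basisVec j))) := by
      simpa using hr1.smul (hPx (T₀.op (basisVec j)))
    refine h1.congr' <| (eventually_gt_atTop j).mono fun m hm => ?_
    simp [hAe, modelColumn, hm]
  refine mem_closure_of_tendsto hlim <| (eventually_gt_atTop 0).mono fun m hm => ⟨?_, ?_, ?_⟩
  · exact almostHitsBasis_of_modelColumn (hAe m)
  · exact almostKillsBasis_of_modelColumn (hAe m)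
  · exact orbitsApproachZero_of_modelColumn hm (hr m) (hP m) T₀.norm_le_one (hPe m) (hAe m)

theorem theorem3p1 :
    Typical (fun T : Contraction ℓ¹(ℕ, ℂ) =>
      (Isometry (banachAdjoint T.op) ∧ ¬ Function.Surjective (banachAdjoint T.op)) ∧
      (∀ z ∈ Metric.ball (0 : ℂ) 1,
        Function.Surjective (T.op - z • ContinuousLinearMap.id ℂ ℓ¹(ℕ, ℂ))) ∧
      (∀ z ∈ Metric.ball (0 : ℂ) 1, IsEigenvalueOfInfiniteMultiplicity T.op z) ∧
      (spectrum ℂ T.op = Metric.closedBall (0 : ℂ) 1 ∧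
        approxPointSpectrum T.op = Metric.closedBall (0 : ℂ) 1) ∧
      (∀ x : ℓ¹(ℕ, ℂ), Tendsto (fun n : ℕ => ‖(T.op ^ n) x‖) atTop (𝓝 0)) ∧
      HasNontrivialInvariantSubspace T.op) := by
  refine ⟨_, isGδ_almostHitsBasis.inter (isGδ_almostKillsBasis.inter isGδ_orbitsApproachZero),
    dense_almostHits_almostKills_orbitsApproachZero, ?_⟩
  rintro ⟨T, hT⟩ ⟨hhit, hkill, horb⟩
  change AlmostHitsBasis T at hhit
  change AlmostKillsBasis T at hkill
  change OrbitsApproachZero T at horb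
  dsimp only
  have hker : ¬ FiniteDimensional ℂ T.ker := by
    obtain ⟨S, hTS, hS⟩ := hhit.exists_rightInverse one_lt_two
    exact hkill.not_finiteDimensional_ker hTS hS
  have hbot : T.ker ≠ ⊥ := fun h => hker (by rw [h]; infer_instance)
  -- A right inverse of norm at most `2 / (1 + ‖z‖)` has norm less than `1 / ‖z‖`.
  have hright : ∀ z ∈ Metric.ball (0 : ℂ) 1, ∃ S, T * S = 1 ∧ ‖z • S‖ < 1 := by
    intro z hz
    rw [mem_ball_zero_iff] at hz
    have hz0 : 0 < 1 + ‖z‖ := by positivity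
    obtain ⟨S, hTS, hS⟩ := hhit.exists_rightInverse
      (r := 2 / (1 + ‖z‖)) (by rw [lt_div_iff₀ hz0]; linarith)
    refine ⟨S, hTS, ?_⟩
    rw [norm_smul]
    refine (mul_le_mul_of_nonneg_left hS (norm_nonneg z)).trans_lt ?_
    rw [← mul_div_assoc, div_lt_one hz0]
    linarith
  have hsurj : ∀ z ∈ Metric.ball (0 : ℂ) 1,
      Function.Surjective (T - z • ContinuousLinearMap.id ℂ ℓ¹(ℕ, ℂ)) := fun z hz =>
    let ⟨_, hTS, hS⟩ := hright z hz
    surjective_sub_smul hTS hS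
  have heig : ∀ z ∈ Metric.ball (0 : ℂ) 1, IsEigenvalueOfInfiniteMultiplicity T z := fun z hz =>
    let ⟨_, hTS, hS⟩ := hright z hz
    isEigenvalueOfInfiniteMultiplicity_iff.2 (not_finiteDimensional_eigenspace hTS hS hker)
  have hap := closedBall_subset_approxPointSpectrum fun z hz => (heig z hz).1
  have hsub := approxPointSpectrum_subset_spectrum T
  have hsp := spectrum_subset_closedBall hT
  refine ⟨⟨isometry_banachAdjoint hT fun r hr => hhit.exists_rightInverse hr,
    not_surjective_banachAdjoint hbot⟩, hsurj, heig,
    ⟨hsp.antisymm (hap.trans hsub), (hsub.trans hsp).antisymm hap⟩, fun x => ?_, ?_⟩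
  · simpa using (horb.tendsto hT x).norm
  · refine hasNontrivialInvariantSubspace_of_ker hbot ?_
    simpa using hsurj 0 (by simp)
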